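/- Let $M\ge 1$, let $\epsilon_1,\dots,\epsilon_M\in(0,1/2)$, and put $\bar C=\sum_{m=1}^M\bigl(\tfrac12-\sqrt{\epsilon_m(1-\epsilon_m)}\bigr)$. A target $X^*$ is a random point of $[0,1]$ with an arbitrary (possibly degenerate) distribution. The sequential $M$-player bisection with step size $\Delta>0$, $K=\Delta^{-1}\in\mathbb N$, implemented by the Burnashev–Zigangirov (BZ) algorithm, runs as follows. Let $I_1=[0,\Delta]$ and $I_i=((i-1)\Delta,i\Delta]$ for $2\le i\le K$. The controller keeps a probability vector $a=(a_1,\dots,a_K)$, representing the density $p=\Delta^{-1}\sum_i a_i 1_{I_i}$ and starting from $a_i=\Delta$ for all $i$. In every cycle the players $m=1,\dots,M$ are asked one question each, in this order: 1. Let $k$ be the index with $\sum_{i<k}a_i\le\frac12<\sum_{i\le k}a_i$, and let $\tau_1=\sum_{i\ge k}a_i-\sum_{i<k}a_i$, $\tau_2=\sum_{i\le k}a_i-\sum_{i>k}a_i$. The query point $q$ is $(k-1)\Delta$ with probability $\tau_2/(\tau_1+\tau_2)$ and $k\Delta$ with probability $\tau_1/(\tau_1+\tau_2)$, conditionally on all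 past queries and answers and on $X^*$. 2. Player $m$ is asked whether $X^*\le q$; conditionally on all past queries and answers, on $X^*$ and on $q$, the answer is correct with probability $1-\epsilon_m$ and wrong with probability $\epsilon_m$. 3. The vector $a$ is replaced by its Bayes update for this answer, computed with the error probability $\alpha_m=\sqrt{\epsilon_m}/(\sqrt{\epsilon_m}+\sqrt{1-\epsilon_m})$: $a_i$ is multiplied by $1-\alpha_m$ if $I_i$ lies on the side of $q$ indicated by the answer and by $\alpha_m$ otherwise, and the result is normalized to total mass $1$. Let $\hat X_n$ be the median of the density $p$ after $n$ full cycles. Then, for every $n\ge 0$: (a) for every step size $\Delta$ with $\Delta^{-1}\in\mathbb N$, $$\mathbb P\bigl(|X^*-\hat X_n|>\Delta\bigr)\le\Bigl(\frac1\Delta-1\Bigr)\exp(-n\bar C);$$ (b) if the step size is chosen as $\Delta=\Delta_n=\bigl\lceil 2^{1/3}e^{n\bar C/3}\bigr\rceil^{-1}$, then $$\mathbb E\bigl[(X^*-\hat X_n)^2\bigr]\le\bigl(2^{-2/3}+2^{1/3}\bigr)\exp\bigl(-\tfrac23 n\bar C\bigr).$$ -/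

import Mathlib

open MeasureTheory ProbabilityTheory

noncomputable section

/-- Posterior mass of the first `j` of the `K` bins, i.e. of `[0, j / K]`. -/
def bzLeft {K : ℕ} (a : Fin K → ℝ) (j : ℕ) : ℝ := ∑ i : Fin K, if i.val < j then a i else 0

/-- Posterior mass of the remaining bins, i.e. of `(j / K, 1]`. -/
def bzRight {K : ℕ} (a : Fin K → ℝ) (j : ℕ) : ℝ := ∑ i : Fin K, if i.val < j then 0 else a i

/-- The (one-based) number `k` of the bin that contains the posterior median: the mass of the
first `k` bins exceeds `1/2`, that of the first `k - 1` bins does not. -/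
def bzMedianBin {K : ℕ} (a : Fin K → ℝ) : ℕ := sInf {k : ℕ | 1 / 2 < bzLeft a k}

/-- Excess of the mass to the right of the left end point of the median bin. -/
def bzTau₁ {K : ℕ} (a : Fin K → ℝ) : ℝ :=
  bzRight a (bzMedianBin a - 1) - bzLeft a (bzMedianBin a - 1)

/-- Excess of the mass to the left of the right end point of the median bin. -/
def bzTau₂ {K : ℕ} (a : Fin K → ℝ) : ℝ :=
  bzLeft a (bzMedianBin a) - bzRight a (bzMedianBin a)

/-- The biased coin of the Burnashev-Zigangirov algorithm: the probability that, at the discretized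
posterior `a`, the next query is placed at the grid point `j / K`. Only the two end points
`(k - 1) / K` and `k / K` of the median bin are used. -/
def bzQueryProb {K : ℕ} (a : Fin K → ℝ) (j : ℕ) : ℝ :=
  if j = bzMedianBin a - 1 then bzTau₂ a / (bzTau₁ a + bzTau₂ a)
  else if j = bzMedianBin a then bzTau₁ a / (bzTau₁ a + bzTau₂ a)
  else 0

/-- Bayes update of the discretized posterior, with assumed error probability `α`, after the answer
`y` to the question "is the target in `[0, j / K]`?" (`true` means yes). -/
def bzUpdate {K : ℕ} (α : ℝ) (a : Fin K → ℝ) (j : ℕ) (y : Bool) : Fin K → ℝ :=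
  fun i => (if (i.val < j ↔ y = true) then 1 - α else α) * a i /
    ∑ l : Fin K, (if (l.val < j ↔ y = true) then 1 - α else α) * a l

/-- The update parameter used for a player with error probability `e`. -/
def bzAlpha (e : ℝ) : ℝ := √e / (√e + √(1 - e))

/-- The discretized posterior after `t` questions, as a function of the grid points `q s / K` that
were queried and of the answers `y s`, `s < t`. Question `t` goes to player `t mod M`, so a cycle
through all the players consists of `M` consecutive questions. The initial posterior is uniform. -/
def bzPosterior {M : ℕ} [NeZero M] (ε : Fin M → ℝ) (K : ℕ) (q : ℕ → ℕ) (y : ℕ → Bool) :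
    ℕ → Fin K → ℝ
  | 0 => fun _ => 1 / (K : ℝ)
  | t + 1 => bzUpdate (bzAlpha (ε (Fin.ofNat M t))) (bzPosterior ε K q y t) (q t) (y t)

/-- The bins `[0, 1 / K]`, `(1 / K, 2 / K]`, …, `((K - 1) / K, 1]`. -/
def bzBin (K : ℕ) (i : Fin K) : Set ℝ :=
  if i.val = 0 then Set.Icc 0 (1 / (K : ℝ))
  else Set.Ioc ((i.val : ℝ) / K) (((i.val : ℝ) + 1) / K)

/-- The piecewise constant density with mass `a i` in bin `i`. -/
def bzDensity {K : ℕ} (a : Fin K → ℝ) (x : ℝ) : ℝ :=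
  (K : ℝ) * ∑ i : Fin K, (bzBin K i).indicator (fun _ => a i) x

/-- The median of the piecewise constant density with masses `a`. -/
def bzMedian {K : ℕ} (a : Fin K → ℝ) : ℝ :=
  sInf {x : ℝ | 0 ≤ x ∧ x ≤ 1 ∧ 1 / 2 ≤ ∫ z in (0 : ℝ)..x, bzDensity a z}

/-- The estimate of the target after `n` full cycles, i.e. after `n * M` questions. -/
def bzEstimate {M : ℕ} [NeZero M] (ε : Fin M → ℝ) (K : ℕ) (q : ℕ → ℕ) (y : ℕ → Bool)
    (n : ℕ) : ℝ :=
  bzMedian (bzPosterior ε K q y (n * M))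

/-- The information of the controller before question `t`: all earlier queries and answers. -/
abbrev bzInfo {Ω : Type*} (Q : ℕ → Ω → ℕ) (Y : ℕ → Ω → Bool) (t : ℕ) : MeasurableSpace Ω :=
  ⨆ s : ℕ, ⨆ _ : s < t,
    MeasurableSpace.comap (Q s) inferInstance ⊔ MeasurableSpace.comap (Y s) inferInstance

/-- A run of the sequential `M`-player bisection by the Burnashev-Zigangirov algorithm with `K` bins:
the target `X` is a random point of the unit interval, question `t` is "is `X ≤ Q t / K`?", put to
player `t mod M`, and `Y t` is the answer.
* Given the past and the target, the query point is drawn by the biased coin of the algorithm.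
* Given the past, the target and the query, the answer is that of a binary symmetric channel with
  the crossover probability of the player who is asked. -/
structure IsBZRun {Ω : Type*} [MeasurableSpace Ω] (μ : Measure Ω) {M : ℕ} [NeZero M]
    (ε : Fin M → ℝ) (K : ℕ) (X : Ω → ℝ) (Q : ℕ → Ω → ℕ) (Y : ℕ → Ω → Bool) : Prop where
  measurable_target : Measurable X
  target_mem : ∀ᵐ ω ∂μ, X ω ∈ Set.Icc (0 : ℝ) 1
  measurable_query : ∀ t, Measurable (Q t)
  measurable_answer : ∀ t, Measurable (Y t)
  query_law : ∀ t j,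
    μ⟦{ω | Q t ω = j} | bzInfo Q Y t ⊔ MeasurableSpace.comap X inferInstance⟧ =ᵐ[μ]
      fun ω => bzQueryProb (bzPosterior ε K (fun s => Q s ω) (fun s => Y s ω) t) j
  answer_law : ∀ t,
    μ⟦{ω | Y t ω = true} | (bzInfo Q Y t ⊔ MeasurableSpace.comap X inferInstance) ⊔
        MeasurableSpace.comap (Q t) inferInstance⟧ =ᵐ[μ]
      fun ω => if X ω ≤ (Q t ω : ℝ) / K then 1 - ε (Fin.ofNat M t) else ε (Fin.ofNat M t)

/-- The rate constant: the sum over the players of `1/2 - √(ε (1 - ε))`. -/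
def bzRate {M : ℕ} (ε : Fin M → ℝ) : ℝ := ∑ m : Fin M, (1 / 2 - √(ε m * (1 - ε m)))

end

/-!
The potential is the odds `1 / a θ - 1` of the posterior `a` against the bin `θ` of the target.
The update parameter `bzAlpha e` is tuned so that, under the true error probability `e`, the mean
inverse likelihood ratio of an answer is `2 √(e (1 - e))`, and the biased coin puts mean mass at
most `(1 + a θ) / 2` on the side of the query that contains `θ`. Together they show that, given the
past and the target, a question to a player with error probability `e` multiplies the mean odds by
at most `1/2 + √(e (1 - e)) ≤ exp (-(1/2 - √(e (1 - e))))`. The initial odds are `K - 1`. If the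
estimate is further than `1 / K` from the target, then the bin of the target has mass at most `1/2`,
so the odds are at least `1`, and Markov's inequality gives (a). The squared error is at most
`1 / K ^ 2`, except with the probability bounded in (a), when it is at most `1`; the step size in
(b) balances these two terms.
-/

theorem sum_range_mul_comp_ofNat {R : Type*} [AddCommMonoid R] {M : ℕ} [NeZero M] (f : Fin M → R)
    (n : ℕ) : ∑ t ∈ Finset.range (n * M), f (Fin.ofNat M t) = n • ∑ m, f m := by
  induction n with
  | zero => simp
  | succ n ih =>
    rw [Nat.succ_mul, Finset.sum_range_add, ih, Finset.sum_range, succ_nsmul]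
    congr 1
    refine Finset.sum_congr rfl fun i _ => congrArg f (Fin.ext ?_)
    simp [Fin.ofNat, Nat.mod_eq_of_lt i.isLt]

section CondExp

variable {Ω : Type*} {m mΩ : MeasurableSpace Ω} {μ : Measure Ω} [IsFiniteMeasure μ]

theorem condExp_comp_ae_eq_sum_mul_condProb {γ : Type*} [MeasurableSpace γ]
    [MeasurableSingletonClass γ] {Z : Ω → γ} (hZ : Measurable Z) {S : Finset γ}
    (hZS : ∀ᵐ ω ∂μ, Z ω ∈ S) {f : γ → Ω → ℝ} (hf : ∀ j ∈ S, StronglyMeasurable[m] (f j))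
    (hfi : ∀ j ∈ S, Integrable (f j) μ) :
    μ[fun ω => f (Z ω) ω | m] =ᵐ[μ] fun ω => ∑ j ∈ S, f j ω * (μ⟦{ω | Z ω = j} | m⟧) ω := by
  classical
  have hset : ∀ j, MeasurableSet {ω | Z ω = j} := fun j => hZ (measurableSet_singleton j)
  have hdecomp : (fun ω => f (Z ω) ω) =ᵐ[μ]
      ∑ j ∈ S, f j * {ω | Z ω = j}.indicator fun _ => (1 : ℝ) := by
    filter_upwards [hZS] with ω hω
    simp [Finset.sum_apply, Set.indicator_apply, hω]
  have hint : ∀ j ∈ S, Integrable (f j * {ω | Z ω = j}.indicator fun _ => (1 : ℝ)) μ := by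
    intro j hj
    have hmul : f j * {ω | Z ω = j}.indicator (fun _ => (1 : ℝ)) = {ω | Z ω = j}.indicator (f j) :=
      funext fun ω => by simp [Set.indicator_apply]
    rw [hmul]
    exact (hfi j hj).indicator (hset j)
  have hpull := fun j (hj : j ∈ S) => condExp_mul_of_stronglyMeasurable_left (hf j hj) (hint j hj)
    ((integrable_const (1 : ℝ)).indicator (hset j))
  filter_upwards [condExp_congr_ae (m := m) hdecomp, condExp_finsetSum hint m,
    (Filter.eventually_all_finset S).2 hpull] with ω hcongr hsum hmul
  rw [hcongr, hsum, Finset.sum_apply]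
  exact Finset.sum_congr rfl hmul

theorem condProb_compl (hm : m ≤ mΩ) {s : Set Ω} (hs : MeasurableSet s) :
    μ⟦sᶜ | m⟧ =ᵐ[μ] fun ω => 1 - (μ⟦s | m⟧) ω := by
  have h := condExp_sub (integrable_const (1 : ℝ)) ((integrable_const (1 : ℝ)).indicator hs) m
    (μ := μ)
  rwa [condExp_const hm, ← Set.indicator_compl] at h

theorem ae_notMem_of_condProb_ae_eq_zero (hm : m ≤ mΩ) {s : Set Ω} (hs : MeasurableSet s)
    (h : μ⟦s | m⟧ =ᵐ[μ] 0) : ∀ᵐ ω ∂μ, ω ∉ s := by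
  rw [← measure_eq_zero_iff_ae_notMem, ← measureReal_eq_zero_iff, ← integral_indicator_one hs]
  calc ∫ ω, s.indicator 1 ω ∂μ = ∫ ω, (μ⟦s | m⟧) ω ∂μ := (integral_condExp hm).symm
    _ = 0 := integral_eq_zero_of_ae h

theorem integrable_sq_of_ae_abs_le_one {Z : Ω → ℝ} (hZ : Measurable Z)
    (hbound : ∀ᵐ ω ∂μ, |Z ω| ≤ 1) : Integrable (fun ω => Z ω ^ 2) μ := by
  refine Integrable.of_bound (hZ.pow_const 2).aestronglyMeasurable 1 (hbound.mono fun ω hω => ?_)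
  rwa [Real.norm_of_nonneg (sq_nonneg _), sq_le_one_iff_abs_le_one]

theorem integral_sq_le_sq_mul_add_measureReal {Z : Ω → ℝ} (hZ : Measurable Z)
    (hbound : ∀ᵐ ω ∂μ, |Z ω| ≤ 1) (δ : ℝ) :
    ∫ ω, Z ω ^ 2 ∂μ ≤ δ ^ 2 * μ.real Set.univ + μ.real {ω | δ < |Z ω|} := by
  have hset : MeasurableSet {ω | δ < |Z ω|} := measurableSet_lt measurable_const (by fun_prop)
  have hind : Integrable ({ω | δ < |Z ω|}.indicator (1 : Ω → ℝ)) μ :=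
    (integrable_const (1 : ℝ)).indicator hset
  calc ∫ ω, Z ω ^ 2 ∂μ ≤ ∫ ω, (δ ^ 2 + {ω | δ < |Z ω|}.indicator 1 ω) ∂μ := by
        refine integral_mono_ae (integrable_sq_of_ae_abs_le_one hZ hbound)
          ((integrable_const _).add hind) ?_
        filter_upwards [hbound] with ω hω
        by_cases h : δ < |Z ω|
        · rw [Set.indicator_of_mem (s := {ω | δ < |Z ω|}) h, Pi.one_apply]
          linarith [(sq_le_one_iff_abs_le_one _).2 hω, sq_nonneg δ]
        · rw [Set.indicator_of_notMem (s := {ω | δ < |Z ω|}) h, add_zero]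
          exact sq_le_sq' (abs_le.1 (not_lt.1 h)).1 (abs_le.1 (not_lt.1 h)).2
    _ = δ ^ 2 * μ.real Set.univ + μ.real {ω | δ < |Z ω|} := by
        rw [integral_add (integrable_const _) hind, integral_indicator_one hset, integral_const,
          smul_eq_mul, mul_comm]

end CondExp

section Bins

variable {K : ℕ} {a : Fin K → ℝ}

theorem bzLeft_zero (a : Fin K → ℝ) : bzLeft a 0 = 0 := by
  simp [bzLeft]

theorem bzLeft_card (a : Fin K → ℝ) : bzLeft a K = ∑ i, a i := by
  simp [bzLeft]

theorem bzLeft_succ (a : Fin K → ℝ) (i : Fin K) : bzLeft a (i + 1) = bzLeft a i + a i := by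
  have hai : a i = ∑ l : Fin K, if l = i then a l else 0 := by simp
  rw [hai, bzLeft, bzLeft, ← Finset.sum_add_distrib]
  refine Finset.sum_congr rfl fun l _ => ?_
  rcases lt_trichotomy l i with h | rfl | h
  · simp [h.ne, Fin.lt_def.1 h, (Fin.lt_def.1 h).trans (Nat.lt_succ_self _)]
  · simp
  · simp [h.ne', not_lt.2 (Fin.lt_def.1 h).le, not_lt.2 (Nat.succ_le_of_lt (Fin.lt_def.1 h))]

theorem bzLeft_add_bzRight (a : Fin K → ℝ) (j : ℕ) : bzLeft a j + bzRight a j = ∑ i, a i := by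
  rw [bzLeft, bzRight, ← Finset.sum_add_distrib]
  exact Finset.sum_congr rfl fun i _ => by split_ifs <;> simp

theorem bzRight_eq_one_sub (ha : ∑ i, a i = 1) (j : ℕ) : bzRight a j = 1 - bzLeft a j :=
  eq_sub_of_add_eq' ((bzLeft_add_bzRight a j).trans ha)

theorem bzLeft_nonneg (ha : ∀ i, 0 ≤ a i) (j : ℕ) : 0 ≤ bzLeft a j :=
  Finset.sum_nonneg fun i _ => by split_ifs; exacts [ha i, le_rfl]

theorem bzRight_nonneg (ha : ∀ i, 0 ≤ a i) (j : ℕ) : 0 ≤ bzRight a j :=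
  Finset.sum_nonneg fun i _ => by split_ifs; exacts [le_rfl, ha i]

theorem bzLeft_le_one (ha : a ∈ stdSimplex ℝ (Fin K)) (j : ℕ) : bzLeft a j ≤ 1 := by
  linarith [bzRight_eq_one_sub ha.2 j, bzRight_nonneg ha.1 j]

theorem exists_bzMedianBin_eq_add_one (ha : 1 / 2 < ∑ i, a i) :
    ∃ i : Fin K, bzMedianBin a = i + 1 ∧ bzLeft a i ≤ 1 / 2 ∧ 1 / 2 < bzLeft a (i + 1) := by
  have hK : 1 / 2 < bzLeft a K := by rwa [bzLeft_card]
  have hmem : 1 / 2 < bzLeft a (bzMedianBin a) :=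
    Nat.sInf_mem (s := {k | 1 / 2 < bzLeft a k}) ⟨K, hK⟩
  have hne : bzMedianBin a ≠ 0 := fun h => by
    rw [h, bzLeft_zero] at hmem
    norm_num at hmem
  obtain ⟨k, hk⟩ := Nat.exists_eq_succ_of_ne_zero hne
  have hkK : k < K := Nat.succ_le_iff.1 (hk ▸ Nat.sInf_le hK)
  refine ⟨⟨k, hkK⟩, hk, not_lt.1 fun h => ?_, by rwa [hk] at hmem⟩
  have hle : bzMedianBin a ≤ k := Nat.sInf_le h
  lia

end Bins

section Median

variable {K : ℕ}

theorem mem_bzBin_iff_of_pos {z : ℝ} (hz : 0 < z) (i : Fin K) :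
    z ∈ bzBin K i ↔ z ∈ Set.Ioc ((i : ℝ) / K) (((i : ℝ) + 1) / K) := by
  unfold bzBin
  split_ifs with h
  · simp [h, hz, hz.le]
  · rfl

theorem measurableSet_bzBin (K : ℕ) (i : Fin K) : MeasurableSet (bzBin K i) := by
  unfold bzBin
  split_ifs
  exacts [measurableSet_Icc, measurableSet_Ioc]

theorem bzDensity_eq_of_mem_Ioc (a : Fin K → ℝ) (i : Fin K) {z : ℝ}
    (hz : z ∈ Set.Ioc ((i : ℝ) / K) (((i : ℝ) + 1) / K)) : bzDensity a z = K * a i := by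
  have hK : (0 : ℝ) < K := by exact_mod_cast i.pos
  have hz0 : 0 < z := lt_of_le_of_lt (by positivity) hz.1
  rw [bzDensity, Finset.sum_eq_single i _ (by simp),
    Set.indicator_of_mem ((mem_bzBin_iff_of_pos hz0 i).2 hz)]
  refine fun l _ hl => Set.indicator_of_notMem (fun hzl => hl (Fin.ext ?_)) _
  rw [mem_bzBin_iff_of_pos hz0] at hzl
  have hil := hz.1.trans_le hzl.2
  have hli := hzl.1.trans_le hz.2
  rw [div_lt_div_iff_of_pos_right hK] at hil hli
  norm_cast at hil hli
  lia

theorem bzDensity_nonneg {a : Fin K → ℝ} (ha : ∀ i, 0 ≤ a i) (z : ℝ) : 0 ≤ bzDensity a z :=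
  mul_nonneg K.cast_nonneg <| Finset.sum_nonneg fun i _ =>
    Set.indicator_nonneg (fun _ _ => ha i) z

theorem intervalIntegrable_bzDensity (a : Fin K → ℝ) (x y : ℝ) :
    IntervalIntegrable (bzDensity a) volume x y := by
  rw [intervalIntegrable_iff, Set.uIoc]
  refine Integrable.const_mul (integrable_finsetSum _ fun i _ => ?_) _
  exact (integrable_const _).indicator (measurableSet_bzBin K i)

theorem integral_bzDensity_bin (a : Fin K → ℝ) (i : Fin K) :
    ∫ z in ((i : ℝ) / K)..(((i : ℝ) + 1) / K), bzDensity a z = a i := by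
  have hK : (0 : ℝ) < K := by exact_mod_cast i.pos
  have hle : (i : ℝ) / K ≤ ((i : ℝ) + 1) / K := by gcongr; linarith
  calc ∫ z in ((i : ℝ) / K)..(((i : ℝ) + 1) / K), bzDensity a z
      = ∫ _ in ((i : ℝ) / K)..(((i : ℝ) + 1) / K), K * a i :=
        intervalIntegral.integral_congr_Ioo_of_le hle fun z hz =>
          bzDensity_eq_of_mem_Ioc a i (Set.Ioo_subset_Ioc_self hz)
    _ = a i := by
        rw [intervalIntegral.integral_const, smul_eq_mul]
        field_simp
        ring

theorem integral_bzDensity_eq_bzLeft (a : Fin K → ℝ) {j : ℕ} (hj : j ≤ K) :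
    ∫ z in (0 : ℝ)..(j / K), bzDensity a z = bzLeft a j := by
  induction j with
  | zero => simp [bzLeft_zero]
  | succ j ih =>
    rw [← intervalIntegral.integral_add_adjacent_intervals (intervalIntegrable_bzDensity a _ _)
      (intervalIntegrable_bzDensity a _ _), ih (Nat.le_of_succ_le hj), Nat.cast_succ,
      integral_bzDensity_bin a ⟨j, hj⟩, bzLeft_succ a ⟨j, hj⟩]

theorem bzMedian_mem_Icc_bin {a : Fin K → ℝ} (ha : ∀ i, 0 ≤ a i) {i : Fin K}
    (hleft : bzLeft a i < 1 / 2) (hright : 1 / 2 ≤ bzLeft a (i + 1)) :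
    bzMedian a ∈ Set.Icc ((i : ℝ) / K) (((i : ℝ) + 1) / K) := by
  have hmem : ((i : ℝ) + 1) / K ∈
      {x : ℝ | 0 ≤ x ∧ x ≤ 1 ∧ 1 / 2 ≤ ∫ z in (0 : ℝ)..x, bzDensity a z} := by
    refine ⟨by positivity, div_le_one_of_le₀ (by exact_mod_cast i.isLt) K.cast_nonneg, ?_⟩
    rwa [← Nat.cast_succ, integral_bzDensity_eq_bzLeft a i.isLt]
  refine ⟨le_csInf ⟨_, hmem⟩ ?_, csInf_le ⟨0, fun x hx => hx.1⟩ hmem⟩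
  rintro x ⟨hx, -, hhalf⟩
  by_contra! hlt
  have hmono : ∫ z in (0 : ℝ)..x, bzDensity a z ≤ bzLeft a i := by
    rw [← integral_bzDensity_eq_bzLeft a i.isLt.le]
    exact intervalIntegral.integral_mono_interval le_rfl hx hlt.le
      (ae_of_all _ (bzDensity_nonneg ha)) (intervalIntegrable_bzDensity a _ _)
  linarith

theorem bzMedian_mem_Icc_zero_one (a : Fin K → ℝ) : bzMedian a ∈ Set.Icc (0 : ℝ) 1 := by
  rcases Set.eq_empty_or_nonempty
    {x : ℝ | 0 ≤ x ∧ x ≤ 1 ∧ 1 / 2 ≤ ∫ z in (0 : ℝ)..x, bzDensity a z} with h | ⟨x, hx⟩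
  · rw [bzMedian, h, Real.sInf_empty]
    exact ⟨le_rfl, zero_le_one⟩
  · exact ⟨le_csInf ⟨x, hx⟩ fun y hy => hy.1, (csInf_le ⟨0, fun y hy => hy.1⟩ hx).trans hx.2.1⟩

/-- The bin that contains the point `x` of the unit interval. For `x ≤ 1` the reduction modulo `K`
in `Fin.ofNat` does nothing. -/
noncomputable def bzTargetBin (K : ℕ) [NeZero K] (x : ℝ) : Fin K := Fin.ofNat K (⌈K * x⌉₊ - 1)

variable [NeZero K]

theorem measurable_bzTargetBin : Measurable (bzTargetBin K) :=
  (Measurable.of_discrete (f := fun n : ℕ => Fin.ofNat K (n - 1))).comp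
    (Nat.measurable_ceil.comp (measurable_const_mul (K : ℝ)))

theorem bzTargetBin_lt_iff {x : ℝ} (hx : x ≤ 1) {j : ℕ} (hj : 0 < j) :
    (bzTargetBin K x : ℕ) < j ↔ x ≤ (j : ℝ) / K := by
  have hK : 0 < K := NeZero.pos K
  have hceil : ⌈K * x⌉₊ ≤ K := Nat.ceil_le.2 (mul_le_of_le_one_right K.cast_nonneg hx)
  have hval : (bzTargetBin K x : ℕ) = ⌈K * x⌉₊ - 1 := Nat.mod_eq_of_lt (by lia)
  rw [hval, le_div_iff₀ (by exact_mod_cast hK), mul_comm x, ← Nat.ceil_le]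
  lia

theorem mem_Icc_bzTargetBin {x : ℝ} (hx : x ∈ Set.Icc (0 : ℝ) 1) :
    x ∈ Set.Icc ((bzTargetBin K x : ℝ) / K) (((bzTargetBin K x : ℝ) + 1) / K) := by
  constructor
  · rcases Nat.eq_zero_or_pos (bzTargetBin K x) with h | h
    · simpa [h] using hx.1
    · exact (not_le.1 fun hle => lt_irrefl _ ((bzTargetBin_lt_iff hx.2 h).2 hle)).le
  · exact_mod_cast (bzTargetBin_lt_iff hx.2 (Nat.succ_pos _)).1 (Nat.lt_succ_self _)

theorem abs_sub_bzMedian_le {a : Fin K → ℝ} (ha : a ∈ stdSimplex ℝ (Fin K)) {x : ℝ}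
    (hx : x ∈ Set.Icc (0 : ℝ) 1) (hmass : 1 / 2 < a (bzTargetBin K x)) :
    |x - bzMedian a| ≤ 1 / K := by
  have hsucc := bzLeft_succ a (bzTargetBin K x)
  have hle := bzLeft_le_one ha (bzTargetBin K x + 1)
  have hnonneg := bzLeft_nonneg ha.1 (bzTargetBin K x)
  have hdist := Real.dist_le_of_mem_Icc (mem_Icc_bzTargetBin hx)
    (bzMedian_mem_Icc_bin ha.1 (i := bzTargetBin K x) (by linarith) (by linarith))
  rwa [Real.dist_eq, ← sub_div, add_sub_cancel_left] at hdist

end Median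

section Update

variable {K : ℕ} {a : Fin K → ℝ} {α : ℝ}

/-- The probability, under the assumed error probability `α`, of the answer `y` to the query `j`
when the target lies in bin `i`. -/
noncomputable def bzLikelihood {K : ℕ} (α : ℝ) (j : ℕ) (y : Bool) (i : Fin K) : ℝ :=
  if (i.val < j ↔ y = true) then 1 - α else α

/-- The normalizing constant of `bzUpdate`: the probability that the posterior `a` assigns to the
answer `y` to the query `j`. -/
noncomputable def bzEvidence {K : ℕ} (α : ℝ) (a : Fin K → ℝ) (j : ℕ) (y : Bool) : ℝ :=
  ∑ i, bzLikelihood α j y i * a i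

theorem bzUpdate_apply (α : ℝ) (a : Fin K → ℝ) (j : ℕ) (y : Bool) (i : Fin K) :
    bzUpdate α a j y i = bzLikelihood α j y i * a i / bzEvidence α a j y :=
  rfl

theorem bzLikelihood_mem_Icc (hα : α ∈ Set.Ioo (0 : ℝ) 1) (j : ℕ) (y : Bool) (i : Fin K) :
    bzLikelihood α j y i ∈ Set.Icc (α * (1 - α)) 1 := by
  obtain ⟨h0, h1⟩ := hα
  unfold bzLikelihood
  split_ifs <;> constructor <;> nlinarith

theorem bzEvidence_mem_Icc (ha : a ∈ stdSimplex ℝ (Fin K)) (hα : α ∈ Set.Ioo (0 : ℝ) 1) (j : ℕ)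
    (y : Bool) : bzEvidence α a j y ∈ Set.Icc (α * (1 - α)) 1 := by
  have hlik := fun i : Fin K => bzLikelihood_mem_Icc hα j y i
  constructor
  · calc α * (1 - α) = ∑ i, α * (1 - α) * a i := by rw [← Finset.mul_sum, ha.2, mul_one]
      _ ≤ bzEvidence α a j y :=
        Finset.sum_le_sum fun i _ => mul_le_mul_of_nonneg_right (hlik i).1 (ha.1 i)
  · exact ha.2 ▸ Finset.sum_le_sum fun i _ => mul_le_of_le_one_left (ha.1 i) (hlik i).2

theorem bzEvidence_pos (ha : a ∈ stdSimplex ℝ (Fin K)) (hα : α ∈ Set.Ioo (0 : ℝ) 1) (j : ℕ)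
    (y : Bool) : 0 < bzEvidence α a j y :=
  (mul_pos hα.1 (sub_pos.2 hα.2)).trans_le (bzEvidence_mem_Icc ha hα j y).1

theorem mul_le_bzUpdate (ha : a ∈ stdSimplex ℝ (Fin K)) (hα : α ∈ Set.Ioo (0 : ℝ) 1) (j : ℕ)
    (y : Bool) (i : Fin K) : α * (1 - α) * a i ≤ bzUpdate α a j y i := by
  have hlik := (bzLikelihood_mem_Icc hα j y i).1
  have hnonneg : 0 ≤ bzLikelihood α j y i * a i :=
    mul_nonneg ((mul_pos hα.1 (sub_pos.2 hα.2)).le.trans hlik) (ha.1 i)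
  calc α * (1 - α) * a i ≤ bzLikelihood α j y i * a i := mul_le_mul_of_nonneg_right hlik (ha.1 i)
    _ ≤ bzUpdate α a j y i :=
      le_div_self hnonneg (bzEvidence_pos ha hα j y) (bzEvidence_mem_Icc ha hα j y).2

theorem bzUpdate_mem_stdSimplex (ha : a ∈ stdSimplex ℝ (Fin K)) (hα : α ∈ Set.Ioo (0 : ℝ) 1)
    (j : ℕ) (y : Bool) : bzUpdate α a j y ∈ stdSimplex ℝ (Fin K) := by
  refine ⟨fun i => le_trans ?_ (mul_le_bzUpdate ha hα j y i), ?_⟩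
  · exact mul_nonneg (mul_pos hα.1 (sub_pos.2 hα.2)).le (ha.1 i)
  · simp only [bzUpdate_apply, ← Finset.sum_div]
    exact div_self (bzEvidence_pos ha hα j y).ne'

theorem bzUpdate_zero (ha : ∑ i, a i = 1) (hα : α ∈ Set.Ioo (0 : ℝ) 1) (y : Bool) :
    bzUpdate α a 0 y = a := by
  have hα' : 1 - α ≠ 0 := (sub_pos.2 hα.2).ne'
  funext i
  cases y <;> simp [bzUpdate, ← Finset.mul_sum, ha, hα.1.ne', hα']

theorem bzUpdate_not (α : ℝ) (a : Fin K → ℝ) (j : ℕ) (y : Bool) :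
    bzUpdate α a j (!y) = bzUpdate (1 - α) a j y := by
  have hlik : ∀ i : Fin K, bzLikelihood α j (!y) i = bzLikelihood (1 - α) j y i := fun i => by
    by_cases h : i.val < j <;> cases y <;> simp [bzLikelihood, h]
  funext i
  simp only [bzUpdate_apply, bzEvidence, hlik]

/-- Mass of the side of the grid point `j` that contains bin `θ`. -/
noncomputable def bzSideMass {K : ℕ} (a : Fin K → ℝ) (θ : Fin K) (j : ℕ) : ℝ :=
  if θ.val < j then bzLeft a j else bzRight a j

theorem bzEvidence_correct (ha : ∑ i, a i = 1) (α : ℝ) (θ : Fin K) (j : ℕ) :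
    bzEvidence α a j (decide (θ.val < j)) =
      (1 - α) * bzSideMass a θ j + α * (1 - bzSideMass a θ j) := by
  have hleft : 1 - bzRight a j = bzLeft a j := by rw [bzRight_eq_one_sub ha, sub_sub_cancel]
  by_cases h : θ.val < j
  · simp only [bzSideMass, h, if_true, ← bzRight_eq_one_sub ha]
    simp only [bzEvidence, bzLikelihood, bzLeft, bzRight, decide_true, iff_true, Finset.mul_sum,
      ← Finset.sum_add_distrib]
    exact Finset.sum_congr rfl fun i _ => by split_ifs <;> ring
  · simp only [bzSideMass, h, if_false, hleft]
    simp only [bzEvidence, bzLikelihood, bzLeft, bzRight, decide_false, Bool.false_eq_true,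
      iff_false, Finset.mul_sum, ← Finset.sum_add_distrib]
    exact Finset.sum_congr rfl fun i _ => by split_ifs <;> ring

/-- The odds against bin `θ` under the posterior `a`, the potential function of the analysis. -/
noncomputable def bzOdds {K : ℕ} (a : Fin K → ℝ) (θ : Fin K) : ℝ := 1 / a θ - 1

theorem bzOdds_nonneg (ha : a ∈ stdSimplex ℝ (Fin K)) {θ : Fin K} (hθ : 0 < a θ) :
    0 ≤ bzOdds a θ :=
  sub_nonneg.2 ((one_le_div hθ).2 (mem_Icc_of_mem_stdSimplex ha θ).2)

theorem one_le_bzOdds {θ : Fin K} (hθ : 0 < a θ) (hhalf : a θ ≤ 1 / 2) : 1 ≤ bzOdds a θ := by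
  have htwo : 2 ≤ 1 / a θ := by rw [le_div_iff₀ hθ]; linarith
  unfold bzOdds
  linarith

theorem bzOdds_bzUpdate_correct (ha : ∑ i, a i = 1) (α : ℝ) (θ : Fin K) (j : ℕ) :
    bzOdds (bzUpdate α a j (decide (θ.val < j))) θ =
      ((1 - α) * bzSideMass a θ j + α * (1 - bzSideMass a θ j)) / ((1 - α) * a θ) - 1 := by
  have hlik : bzLikelihood α j (decide (θ.val < j)) θ = 1 - α := by simp [bzLikelihood]
  rw [bzOdds, bzUpdate_apply, hlik, bzEvidence_correct ha, one_div_div]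

theorem bzOdds_bzUpdate_wrong (ha : ∑ i, a i = 1) (α : ℝ) (θ : Fin K) (j : ℕ) :
    bzOdds (bzUpdate α a j (!decide (θ.val < j))) θ =
      (α * bzSideMass a θ j + (1 - α) * (1 - bzSideMass a θ j)) / (α * a θ) - 1 := by
  rw [bzUpdate_not, bzOdds_bzUpdate_correct ha, sub_sub_cancel]

end Update

section Contraction

variable {K : ℕ} {a : Fin K → ℝ} {e : ℝ}

theorem one_sub_bzAlpha (he : 0 < e) : 1 - bzAlpha e = √(1 - e) / (√e + √(1 - e)) := by
  have hsum : 0 < √e + √(1 - e) :=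
    add_pos_of_pos_of_nonneg (Real.sqrt_pos.2 he) (Real.sqrt_nonneg _)
  rw [bzAlpha, one_sub_div hsum.ne', add_sub_cancel_left]

theorem bzAlpha_mem_Ioo (he : e ∈ Set.Ioo (0 : ℝ) 1) : bzAlpha e ∈ Set.Ioo (0 : ℝ) 1 := by
  have hpos : 0 < √e := Real.sqrt_pos.2 he.1
  have hpos' : 0 < √(1 - e) := Real.sqrt_pos.2 (sub_pos.2 he.2)
  refine ⟨by unfold bzAlpha; positivity, sub_pos.1 ?_⟩
  rw [one_sub_bzAlpha he.1]
  positivity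

/-- The parameter `bzAlpha e` is the minimizer of the left-hand side over the assumed error
probability. -/
theorem bzAlpha_mean_likelihood_ratio (he : e ∈ Set.Ioo (0 : ℝ) 1) :
    (1 - e) * (bzAlpha e / (1 - bzAlpha e)) + e * ((1 - bzAlpha e) / bzAlpha e) =
      2 * √(e * (1 - e)) := by
  have hpos : 0 < √e := Real.sqrt_pos.2 he.1
  have hpos' : 0 < √(1 - e) := Real.sqrt_pos.2 (sub_pos.2 he.2)
  have hsum : √e + √(1 - e) ≠ 0 := by positivity
  have hsq : √e ^ 2 = e := Real.sq_sqrt he.1.le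
  have hsq' : √(1 - e) ^ 2 = 1 - e := Real.sq_sqrt (sub_pos.2 he.2).le
  rw [one_sub_bzAlpha he.1, bzAlpha, Real.sqrt_mul he.1.le, div_div_div_cancel_right₀ hsum,
    div_div_div_cancel_right₀ hsum]
  field_simp
  rw [hsq, hsq']
  ring

theorem sqrt_mul_one_sub_le_half (e : ℝ) : √(e * (1 - e)) ≤ 1 / 2 :=
  (Real.sqrt_le_left (by norm_num)).2 (by nlinarith [sq_nonneg (e - 1 / 2)])

/-- The mean odds against bin `θ` after the query `j`, when `θ` contains the target and the answer
is wrong with probability `e`. -/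
noncomputable def bzMeanOdds {K : ℕ} (e : ℝ) (a : Fin K → ℝ) (θ : Fin K) (j : ℕ) : ℝ :=
  (1 - e) * bzOdds (bzUpdate (bzAlpha e) a j (decide (θ.val < j))) θ +
    e * bzOdds (bzUpdate (bzAlpha e) a j (!decide (θ.val < j))) θ

theorem bzMeanOdds_eq (ha : ∑ i, a i = 1) (he : e ∈ Set.Ioo (0 : ℝ) 1) {θ : Fin K}
    (hθ : a θ ≠ 0) (j : ℕ) :
    bzMeanOdds e a θ j =
      (bzSideMass a θ j + 2 * √(e * (1 - e)) * (1 - bzSideMass a θ j)) / a θ - 1 := by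
  have hα : bzAlpha e ≠ 0 := (bzAlpha_mem_Ioo he).1.ne'
  have hα' : 1 - bzAlpha e ≠ 0 := (sub_pos.2 (bzAlpha_mem_Ioo he).2).ne'
  rw [bzMeanOdds, bzOdds_bzUpdate_correct ha, bzOdds_bzUpdate_wrong ha,
    ← bzAlpha_mean_likelihood_ratio he]
  field_simp
  ring

theorem bzMeanOdds_eq_of_pos_imp (ha : ∑ i, a i = 1) (he : e ∈ Set.Ioo (0 : ℝ) 1) {θ : Fin K}
    {j : ℕ} {c : Bool} (hc : 0 < j → c = decide (θ.val < j)) :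
    bzMeanOdds e a θ j =
      (1 - e) * bzOdds (bzUpdate (bzAlpha e) a j c) θ +
        e * bzOdds (bzUpdate (bzAlpha e) a j (!c)) θ := by
  rcases Nat.eq_zero_or_pos j with rfl | hj
  · simp only [bzMeanOdds, bzUpdate_zero ha (bzAlpha_mem_Ioo he)]
  · rw [bzMeanOdds, hc hj]

theorem sum_bzQueryProb_mul {i : Fin K} (hi : bzMedianBin a = i + 1) (φ : ℕ → ℝ) :
    ∑ j ∈ Finset.range (K + 1), bzQueryProb a j * φ j =
      bzTau₂ a / (bzTau₁ a + bzTau₂ a) * φ i +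
        bzTau₁ a / (bzTau₁ a + bzTau₂ a) * φ (i + 1) := by
  rw [← Finset.sum_subset (s₁ := {i.val, i.val + 1}), Finset.sum_pair (by lia)]
  · simp [bzQueryProb, hi]
  · exact fun j hj => Finset.mem_range.2 (by grind)
  · intro j _ hj
    simp only [Finset.mem_insert, Finset.mem_singleton, not_or] at hj
    simp [bzQueryProb, hi, hj.1, hj.2]

theorem bzQueryProb_eq_zero_of_lt (ha : 1 / 2 < ∑ i, a i) {j : ℕ} (hj : K < j) :
    bzQueryProb a j = 0 := by
  obtain ⟨i, hi, -⟩ := exists_bzMedianBin_eq_add_one ha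
  rw [bzQueryProb, hi, if_neg (by lia), if_neg (by lia)]

theorem bzTau₁_eq (ha : ∑ i, a i = 1) {i : Fin K} (hi : bzMedianBin a = i + 1) :
    bzTau₁ a = 1 - 2 * bzLeft a i := by
  rw [bzTau₁, hi, bzRight_eq_one_sub ha, Nat.add_sub_cancel]
  ring

theorem bzTau₂_eq (ha : ∑ i, a i = 1) {i : Fin K} (hi : bzMedianBin a = i + 1) :
    bzTau₂ a = 2 * (bzLeft a i + a i) - 1 := by
  rw [bzTau₂, hi, bzRight_eq_one_sub ha, bzLeft_succ]
  ring

theorem bzTau₁_add_bzTau₂ (ha : ∑ i, a i = 1) {i : Fin K} (hi : bzMedianBin a = i + 1) :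
    bzTau₁ a + bzTau₂ a = 2 * a i := by
  rw [bzTau₁_eq ha hi, bzTau₂_eq ha hi]
  ring

theorem sum_bzQueryProb (ha : ∑ i, a i = 1) :
    ∑ j ∈ Finset.range (K + 1), bzQueryProb a j = 1 := by
  obtain ⟨i, hi, hleft, hright⟩ := exists_bzMedianBin_eq_add_one (a := a) (by rw [ha]; norm_num)
  have hsum := bzTau₁_add_bzTau₂ ha hi
  have hne : bzTau₁ a + bzTau₂ a ≠ 0 := by
    rw [bzLeft_succ] at hright
    linarith
  have h := sum_bzQueryProb_mul hi fun _ => 1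
  simp only [mul_one] at h
  rw [h, ← add_div, add_comm, div_self hne]

/-- The coin is biased so that both sides of the query have mean mass exactly `1 / 2`; only the
median bin, which changes sides between the two candidate queries, adds to this. -/
theorem sum_bzQueryProb_mul_bzSideMass_le (ha : a ∈ stdSimplex ℝ (Fin K)) (θ : Fin K) :
    ∑ j ∈ Finset.range (K + 1), bzQueryProb a j * bzSideMass a θ j ≤ (1 + a θ) / 2 := by
  obtain ⟨i, hi, hleft, hright⟩ :=
    exists_bzMedianBin_eq_add_one (a := a) (by rw [ha.2]; norm_num)
  rw [bzLeft_succ] at hright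
  have hai : 0 < a i := by linarith
  suffices h : bzTau₂ a * bzSideMass a θ i + bzTau₁ a * bzSideMass a θ (i + 1) ≤
      a i * (1 + a θ) by
    rw [sum_bzQueryProb_mul hi, bzTau₁_add_bzTau₂ ha.2 hi, div_mul_eq_mul_div, div_mul_eq_mul_div,
      ← add_div, div_le_iff₀ (by positivity)]
    linarith
  have hθ : 0 ≤ a i * a θ := mul_nonneg hai.le (ha.1 θ)
  rw [bzTau₁_eq ha.2 hi, bzTau₂_eq ha.2 hi, bzSideMass, bzSideMass, bzRight_eq_one_sub ha.2,
    bzRight_eq_one_sub ha.2, bzLeft_succ]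
  rcases lt_trichotomy θ.val i.val with h | h | h
  · rw [if_pos h, if_pos (Nat.lt_succ_of_lt h)]
    linarith
  · obtain rfl := Fin.ext h
    rw [if_neg (lt_irrefl _), if_pos (Nat.lt_succ_self _)]
    nlinarith [sq_nonneg (2 * bzLeft a θ + a θ - 1)]
  · rw [if_neg (not_lt.2 h.le), if_neg (not_lt.2 (Nat.succ_le_of_lt h))]
    linarith

theorem sum_bzQueryProb_mul_bzMeanOdds_le (ha : a ∈ stdSimplex ℝ (Fin K))
    (he : e ∈ Set.Ioo (0 : ℝ) 1) {θ : Fin K} (hθ : 0 < a θ) :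
    ∑ j ∈ Finset.range (K + 1), bzQueryProb a j * bzMeanOdds e a θ j ≤
      (1 / 2 + √(e * (1 - e))) * bzOdds a θ := by
  have hside := sum_bzQueryProb_mul_bzSideMass_le ha θ
  have hhalf := sqrt_mul_one_sub_le_half e
  set r := √(e * (1 - e))
  calc ∑ j ∈ Finset.range (K + 1), bzQueryProb a j * bzMeanOdds e a θ j
      = ∑ j ∈ Finset.range (K + 1), ((1 - 2 * r) / a θ * (bzQueryProb a j * bzSideMass a θ j) +
          (2 * r / a θ - 1) * bzQueryProb a j) :=
        Finset.sum_congr rfl fun j _ => by rw [bzMeanOdds_eq ha.2 he hθ.ne']; ring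
    _ = (1 - 2 * r) / a θ * ∑ j ∈ Finset.range (K + 1), bzQueryProb a j * bzSideMass a θ j +
          (2 * r / a θ - 1) := by
        rw [Finset.sum_add_distrib, ← Finset.mul_sum, ← Finset.mul_sum, sum_bzQueryProb ha.2,
          mul_one]
    _ ≤ (1 - 2 * r) / a θ * ((1 + a θ) / 2) + (2 * r / a θ - 1) := by
        have hcoef : 0 ≤ (1 - 2 * r) / a θ := div_nonneg (by linarith) hθ.le
        gcongr
    _ = (1 / 2 + r) * bzOdds a θ := by
        unfold bzOdds
        field_simp
        ring

end Contraction

section Posterior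

variable {M : ℕ} [NeZero M] {ε : Fin M → ℝ} {K : ℕ}

theorem bzPosterior_mem_stdSimplex [NeZero K] (hε : ∀ m, ε m ∈ Set.Ioo (0 : ℝ) 1) (q : ℕ → ℕ)
    (y : ℕ → Bool) (t : ℕ) : bzPosterior ε K q y t ∈ stdSimplex ℝ (Fin K) := by
  induction t with
  | zero =>
    rw [bzPosterior]
    exact ⟨fun _ => by positivity, by simp⟩
  | succ t ih => exact bzUpdate_mem_stdSimplex ih (bzAlpha_mem_Ioo (hε _)) _ _

theorem exists_pos_forall_le_bzPosterior [NeZero K] (hε : ∀ m, ε m ∈ Set.Ioo (0 : ℝ) 1) (t : ℕ) :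
    ∃ c > 0, ∀ q y i, c ≤ bzPosterior ε K q y t i := by
  induction t with
  | zero => exact ⟨1 / K, by simp [NeZero.pos K], fun _ _ _ => le_rfl⟩
  | succ t ih =>
    obtain ⟨c, hc, hle⟩ := ih
    have hα := bzAlpha_mem_Ioo (hε (Fin.ofNat M t))
    have hpos := mul_pos hα.1 (sub_pos.2 hα.2)
    exact ⟨_, mul_pos hpos hc, fun q y i =>
      (mul_le_mul_of_nonneg_left (hle q y i) hpos.le).trans
        (mul_le_bzUpdate (bzPosterior_mem_stdSimplex hε q y t) hα _ _ i)⟩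

theorem bzPosterior_pos [NeZero K] (hε : ∀ m, ε m ∈ Set.Ioo (0 : ℝ) 1) (q : ℕ → ℕ)
    (y : ℕ → Bool) (t : ℕ) (i : Fin K) : 0 < bzPosterior ε K q y t i :=
  let ⟨_, hc, hle⟩ := exists_pos_forall_le_bzPosterior hε t
  hc.trans_le (hle q y i)

/-- The posterior of a run after `t` questions, as a random vector. -/
noncomputable abbrev bzRunPosterior {Ω : Type*} (ε : Fin M → ℝ) (K : ℕ) (Q : ℕ → Ω → ℕ)
    (Y : ℕ → Ω → Bool) (t : ℕ) (ω : Ω) : Fin K → ℝ :=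
  bzPosterior ε K (fun s => Q s ω) (fun s => Y s ω) t

/-- The map `φ` is arbitrary: the posterior is a function of finitely many discrete random
variables. -/
theorem measurable_bzRunPosterior_comp {Ω β γ : Type*} {m : MeasurableSpace Ω} [MeasurableSpace β]
    [MeasurableSpace γ] [Countable γ] [MeasurableSingletonClass γ] {Q : ℕ → Ω → ℕ}
    {Y : ℕ → Ω → Bool} {t : ℕ} (hm : bzInfo Q Y t ≤ m) {Z : Ω → γ} (hZ : Measurable[m] Z)
    (φ : (Fin K → ℝ) → γ → β) :
    Measurable[m] fun ω => φ (bzRunPosterior ε K Q Y t ω) (Z ω) := by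
  induction t generalizing γ with
  | zero => exact (Measurable.of_discrete (f := φ fun _ => 1 / (K : ℝ))).comp hZ
  | succ t ih =>
    have hpast : bzInfo Q Y t ≤ bzInfo Q Y (t + 1) :=
      biSup_mono fun s hs => hs.trans t.lt_succ_self
    have hnow : MeasurableSpace.comap (Q t) inferInstance ⊔
        MeasurableSpace.comap (Y t) inferInstance ≤ bzInfo Q Y (t + 1) :=
      le_iSup₂_of_le t t.lt_succ_self le_rfl
    have hQ : Measurable[m] (Q t) :=
      measurable_iff_comap_le.2 (le_sup_left.trans (hnow.trans hm))
    have hY : Measurable[m] (Y t) :=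
      measurable_iff_comap_le.2 (le_sup_right.trans (hnow.trans hm))
    exact ih (hpast.trans hm) (hZ.prodMk (hQ.prodMk hY)) fun a p =>
      φ (bzUpdate (bzAlpha (ε (Fin.ofNat M t))) a p.2.1 p.2.2) p.1

end Posterior

section Run

variable {Ω : Type*} {M : ℕ} [NeZero M] {ε : Fin M → ℝ} {K : ℕ} [NeZero K] {X : Ω → ℝ}
  {Q : ℕ → Ω → ℕ} {Y : ℕ → Ω → Bool}

/-- The information before question `t` of an observer who also knows the target. -/
abbrev bzTargetInfo (X : Ω → ℝ) (Q : ℕ → Ω → ℕ) (Y : ℕ → Ω → Bool) (t : ℕ) : MeasurableSpace Ω :=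
  bzInfo Q Y t ⊔ MeasurableSpace.comap X inferInstance

/-- The information of this observer once question `t` has been chosen but not yet answered. -/
abbrev bzQueryInfo (X : Ω → ℝ) (Q : ℕ → Ω → ℕ) (Y : ℕ → Ω → Bool) (t : ℕ) : MeasurableSpace Ω :=
  bzTargetInfo X Q Y t ⊔ MeasurableSpace.comap (Q t) inferInstance

/-- The posterior odds against the bin of the target after `t` questions of a run. -/
noncomputable def bzRunOdds (ε : Fin M → ℝ) (K : ℕ) [NeZero K] (X : Ω → ℝ) (Q : ℕ → Ω → ℕ)
    (Y : ℕ → Ω → Bool) (t : ℕ) (ω : Ω) : ℝ :=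
  bzOdds (bzRunPosterior ε K Q Y t ω) (bzTargetBin K (X ω))

theorem bzRunOdds_nonneg (hε : ∀ m, ε m ∈ Set.Ioo (0 : ℝ) 1) (t : ℕ) (ω : Ω) :
    0 ≤ bzRunOdds ε K X Q Y t ω :=
  bzOdds_nonneg (bzPosterior_mem_stdSimplex hε _ _ t) (bzPosterior_pos hε _ _ t _)

theorem measurable_target_bzTargetInfo (t : ℕ) : Measurable[bzTargetInfo X Q Y t] X :=
  measurable_iff_comap_le.2 le_sup_right

theorem measurable_target_bzQueryInfo (t : ℕ) : Measurable[bzQueryInfo X Q Y t] X :=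
  (measurable_target_bzTargetInfo t).mono le_sup_left le_rfl

theorem measurable_query_bzQueryInfo (t : ℕ) : Measurable[bzQueryInfo X Q Y t] (Q t) :=
  measurable_iff_comap_le.2 le_sup_right

theorem measurable_bzOdds_bzUpdate {m : MeasurableSpace Ω} {t : ℕ} (hm : bzInfo Q Y t ≤ m)
    (hX : Measurable[m] X) (α : ℝ) {J : Ω → ℕ} (hJ : Measurable[m] J) {B : Ω → Bool}
    (hB : Measurable[m] B) :
    Measurable[m] fun ω =>
      bzOdds (bzUpdate α (bzRunPosterior ε K Q Y t ω) (J ω) (B ω)) (bzTargetBin K (X ω)) :=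
  measurable_bzRunPosterior_comp hm
    ((measurable_bzTargetBin.comp hX).prodMk (hJ.prodMk hB))
    fun a p => bzOdds (bzUpdate α a p.2.1 p.2.2) p.1

theorem measurable_bzMeanOdds {m : MeasurableSpace Ω} {t : ℕ} (hm : bzInfo Q Y t ≤ m)
    (hX : Measurable[m] X) (e : ℝ) (j : ℕ) :
    Measurable[m] fun ω => bzMeanOdds e (bzRunPosterior ε K Q Y t ω) (bzTargetBin K (X ω)) j :=
  measurable_bzRunPosterior_comp hm (measurable_bzTargetBin.comp hX) fun a θ => bzMeanOdds e a θ j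

end Run

namespace IsBZRun

variable {Ω : Type*} [mΩ : MeasurableSpace Ω] {μ : Measure Ω} {M : ℕ} [NeZero M]
  {ε : Fin M → ℝ} {K : ℕ} {X : Ω → ℝ} {Q : ℕ → Ω → ℕ} {Y : ℕ → Ω → Bool}

theorem bzInfo_le (hrun : IsBZRun μ ε K X Q Y) (t : ℕ) : bzInfo Q Y t ≤ mΩ :=
  iSup₂_le fun s _ => sup_le (hrun.measurable_query s).comap_le (hrun.measurable_answer s).comap_le

theorem bzTargetInfo_le (hrun : IsBZRun μ ε K X Q Y) (t : ℕ) : bzTargetInfo X Q Y t ≤ mΩ :=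
  sup_le (hrun.bzInfo_le t) hrun.measurable_target.comap_le

theorem bzQueryInfo_le (hrun : IsBZRun μ ε K X Q Y) (t : ℕ) : bzQueryInfo X Q Y t ≤ mΩ :=
  sup_le (hrun.bzTargetInfo_le t) (hrun.measurable_query t).comap_le

theorem measurable_bzEstimate (hrun : IsBZRun μ ε K X Q Y) (n : ℕ) :
    Measurable fun ω => bzEstimate ε K (fun t => Q t ω) (fun t => Y t ω) n :=
  measurable_bzRunPosterior_comp (hrun.bzInfo_le (n * M)) (measurable_const (a := ()))
    fun a _ => bzMedian a

theorem ae_abs_sub_bzEstimate_le_one (hrun : IsBZRun μ ε K X Q Y) (n : ℕ) :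
    ∀ᵐ ω ∂μ, |X ω - bzEstimate ε K (fun t => Q t ω) (fun t => Y t ω) n| ≤ 1 := by
  filter_upwards [hrun.target_mem] with ω hX
  exact Real.dist_le_of_mem_Icc_01 hX (bzMedian_mem_Icc_zero_one _)

variable [IsProbabilityMeasure μ]

theorem condProb_answer (hrun : IsBZRun μ ε K X Q Y) (t : ℕ) (b : Bool) :
    μ⟦{ω | Y t ω = b} | bzQueryInfo X Q Y t⟧ =ᵐ[μ] fun ω =>
      if b = decide (X ω ≤ (Q t ω : ℝ) / K) then 1 - ε (Fin.ofNat M t)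
      else ε (Fin.ofNat M t) := by
  cases b with
  | true =>
    filter_upwards [hrun.answer_law t] with ω hω
    simp only [hω, eq_comm (a := true), decide_eq_true_eq]
  | false =>
    have hset : {ω | Y t ω = false} = {ω | Y t ω = true}ᶜ := by ext; simp
    rw [hset]
    filter_upwards [condProb_compl (s := {ω | Y t ω = true}) (hrun.bzQueryInfo_le t)
      (hrun.measurable_answer t (measurableSet_singleton true)), hrun.answer_law t] with ω hcompl hω
    rw [hcompl, hω]
    by_cases h : X ω ≤ (Q t ω : ℝ) / K <;> simp [h]

variable [NeZero K]

theorem integrable_bzOdds_bzUpdate (hrun : IsBZRun μ ε K X Q Y)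
    (hε : ∀ m, ε m ∈ Set.Ioo (0 : ℝ) 1) (t : ℕ) {α : ℝ} (hα : α ∈ Set.Ioo (0 : ℝ) 1)
    {J : Ω → ℕ} (hJ : Measurable J) {B : Ω → Bool} (hB : Measurable B) :
    Integrable (fun ω =>
      bzOdds (bzUpdate α (bzRunPosterior ε K Q Y t ω) (J ω) (B ω)) (bzTargetBin K (X ω))) μ := by
  obtain ⟨c, hc, hle⟩ := exists_pos_forall_le_bzPosterior (K := K) hε t
  have hα' : 0 < α * (1 - α) := mul_pos hα.1 (sub_pos.2 hα.2)
  refine Integrable.of_bound (measurable_bzOdds_bzUpdate (hrun.bzInfo_le t) hrun.measurable_target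
    α hJ hB).aestronglyMeasurable (1 / (α * (1 - α) * c)) (ae_of_all _ fun ω => ?_)
  have ha := bzPosterior_mem_stdSimplex (K := K) hε (fun s => Q s ω) (fun s => Y s ω) t
  have hlow := (mul_le_mul_of_nonneg_left (hle _ _ _) hα'.le).trans
    (mul_le_bzUpdate ha hα (J ω) (B ω) (bzTargetBin K (X ω)))
  have hpos := (mul_pos hα' hc).trans_le hlow
  rw [Real.norm_of_nonneg (bzOdds_nonneg (bzUpdate_mem_stdSimplex ha hα _ _) hpos), bzOdds]
  linarith [one_div_le_one_div_of_le (mul_pos hα' hc) hlow]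

theorem integrable_bzRunOdds (hrun : IsBZRun μ ε K X Q Y) (hε : ∀ m, ε m ∈ Set.Ioo (0 : ℝ) 1)
    (t : ℕ) : Integrable (bzRunOdds ε K X Q Y t) μ := by
  cases t with
  | zero => exact integrable_const (1 / (1 / (K : ℝ)) - 1)
  | succ t =>
    exact hrun.integrable_bzOdds_bzUpdate hε t (bzAlpha_mem_Ioo (hε _)) (hrun.measurable_query t)
      (hrun.measurable_answer t)

theorem integrable_bzMeanOdds (hrun : IsBZRun μ ε K X Q Y) (hε : ∀ m, ε m ∈ Set.Ioo (0 : ℝ) 1)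
    (t : ℕ) {e : ℝ} (he : e ∈ Set.Ioo (0 : ℝ) 1) (j : ℕ) :
    Integrable (fun ω => bzMeanOdds e (bzRunPosterior ε K Q Y t ω) (bzTargetBin K (X ω)) j) μ := by
  have hside (g : Fin K → Bool) : Measurable fun ω => g (bzTargetBin K (X ω)) :=
    Measurable.of_discrete.comp (measurable_bzTargetBin.comp hrun.measurable_target)
  have hodds (g : Fin K → Bool) := hrun.integrable_bzOdds_bzUpdate hε t (bzAlpha_mem_Ioo he)
    (measurable_const (a := j)) (hside g)
  exact ((hodds fun θ => decide (θ.val < j)).const_mul _).add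
    ((hodds fun θ => !decide (θ.val < j)).const_mul _)

theorem ae_query_le (hrun : IsBZRun μ ε K X Q Y) (hε : ∀ m, ε m ∈ Set.Ioo (0 : ℝ) 1) (t : ℕ) :
    ∀ᵐ ω ∂μ, Q t ω ≤ K := by
  have hne : ∀ j, K < j → ∀ᵐ ω ∂μ, Q t ω ≠ j := fun j hj =>
    ae_notMem_of_condProb_ae_eq_zero (hrun.bzTargetInfo_le t)
      (hrun.measurable_query t (measurableSet_singleton j)) <|
      (hrun.query_law t j).trans <| ae_of_all _ fun ω => bzQueryProb_eq_zero_of_lt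
        (by rw [(bzPosterior_mem_stdSimplex hε _ _ t).2]; norm_num) hj
  filter_upwards [ae_all_iff.2 fun j => ae_all_iff.2 (hne j)] with ω hω
  exact not_lt.1 fun hlt => hω _ hlt rfl

theorem condExp_bzRunOdds_succ (hrun : IsBZRun μ ε K X Q Y) (hε : ∀ m, ε m ∈ Set.Ioo (0 : ℝ) 1)
    (t : ℕ) :
    μ[bzRunOdds ε K X Q Y (t + 1) | bzQueryInfo X Q Y t] =ᵐ[μ] fun ω =>
      bzMeanOdds (ε (Fin.ofNat M t)) (bzRunPosterior ε K Q Y t ω) (bzTargetBin K (X ω))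
        (Q t ω) := by
  have he := hε (Fin.ofNat M t)
  have hsum := condExp_comp_ae_eq_sum_mul_condProb (μ := μ) (m := bzQueryInfo X Q Y t)
    (hrun.measurable_answer t) (S := Finset.univ) (ae_of_all _ fun _ => Finset.mem_univ _)
    (fun b _ => (measurable_bzOdds_bzUpdate (ε := ε) (K := K) (le_sup_left.trans le_sup_left)
      (measurable_target_bzQueryInfo t) (bzAlpha (ε (Fin.ofNat M t)))
      (measurable_query_bzQueryInfo t) (measurable_const (a := b))).stronglyMeasurable)
    fun b _ => hrun.integrable_bzOdds_bzUpdate hε t (bzAlpha_mem_Ioo he) (hrun.measurable_query t)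
      measurable_const
  filter_upwards [hsum, hrun.condProb_answer t true, hrun.condProb_answer t false,
    hrun.target_mem] with ω hω htrue hfalse hX
  rw [bzMeanOdds_eq_of_pos_imp (c := decide (X ω ≤ (Q t ω : ℝ) / K))
    (bzPosterior_mem_stdSimplex hε _ _ t).2 he
    fun hj => decide_eq_decide.2 (bzTargetBin_lt_iff hX.2 hj).symm]
  refine hω.trans ?_
  rw [Fintype.sum_bool, htrue, hfalse]
  by_cases h : X ω ≤ (Q t ω : ℝ) / K <;> simp [h] <;> ring

theorem condExp_bzRunOdds_succ_le (hrun : IsBZRun μ ε K X Q Y)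
    (hε : ∀ m, ε m ∈ Set.Ioo (0 : ℝ) 1) (t : ℕ) :
    μ[bzRunOdds ε K X Q Y (t + 1) | bzTargetInfo X Q Y t] ≤ᵐ[μ] fun ω =>
      (1 / 2 + √(ε (Fin.ofNat M t) * (1 - ε (Fin.ofNat M t)))) * bzRunOdds ε K X Q Y t ω := by
  have he := hε (Fin.ofNat M t)
  have htower := (condExp_condExp_of_le le_sup_left (hrun.bzQueryInfo_le t)).symm.trans
    (condExp_congr_ae (m := bzTargetInfo X Q Y t) (hrun.condExp_bzRunOdds_succ hε t))
  have hsum := condExp_comp_ae_eq_sum_mul_condProb (μ := μ) (m := bzTargetInfo X Q Y t)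
    (hrun.measurable_query t) (S := Finset.range (K + 1))
    ((hrun.ae_query_le hε t).mono fun ω hω => Finset.mem_range.2 (Nat.lt_succ_of_le hω))
    (fun j _ => (measurable_bzMeanOdds (ε := ε) (K := K) le_sup_left
      (measurable_target_bzTargetInfo t) (ε (Fin.ofNat M t)) j).stronglyMeasurable)
    fun j _ => hrun.integrable_bzMeanOdds hε t he j
  filter_upwards [htower, hsum, ae_all_iff.2 (hrun.query_law t)] with ω htower hsum hquery
  rw [htower, hsum]
  simp only [hquery, mul_comm (bzMeanOdds _ _ _ _)]
  exact sum_bzQueryProb_mul_bzMeanOdds_le (bzPosterior_mem_stdSimplex hε _ _ t) he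
    (bzPosterior_pos hε _ _ t _)

theorem integral_bzRunOdds_succ_le (hrun : IsBZRun μ ε K X Q Y)
    (hε : ∀ m, ε m ∈ Set.Ioo (0 : ℝ) 1) (t : ℕ) :
    ∫ ω, bzRunOdds ε K X Q Y (t + 1) ω ∂μ ≤
      (1 / 2 + √(ε (Fin.ofNat M t) * (1 - ε (Fin.ofNat M t)))) *
        ∫ ω, bzRunOdds ε K X Q Y t ω ∂μ := by
  rw [← integral_condExp (hrun.bzTargetInfo_le t), ← integral_const_mul]
  exact integral_mono_ae integrable_condExp ((hrun.integrable_bzRunOdds hε t).const_mul _)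
    (hrun.condExp_bzRunOdds_succ_le hε t)

theorem integral_bzRunOdds_le (hrun : IsBZRun μ ε K X Q Y) (hε : ∀ m, ε m ∈ Set.Ioo (0 : ℝ) 1)
    (t : ℕ) :
    ∫ ω, bzRunOdds ε K X Q Y t ω ∂μ ≤ ((K : ℝ) - 1) * Real.exp (-∑ s ∈ Finset.range t,
      (1 / 2 - √(ε (Fin.ofNat M s) * (1 - ε (Fin.ofNat M s))))) := by
  induction t with
  | zero => simp [bzRunOdds, bzOdds, bzPosterior]
  | succ t ih =>
    set r := √(ε (Fin.ofNat M t) * (1 - ε (Fin.ofNat M t)))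
    have hexp : 1 / 2 + r ≤ Real.exp (-(1 / 2 - r)) := by
      linarith [Real.add_one_le_exp (-(1 / 2 - r))]
    calc ∫ ω, bzRunOdds ε K X Q Y (t + 1) ω ∂μ
        ≤ (1 / 2 + r) * ∫ ω, bzRunOdds ε K X Q Y t ω ∂μ := hrun.integral_bzRunOdds_succ_le hε t
      _ ≤ Real.exp (-(1 / 2 - r)) * ∫ ω, bzRunOdds ε K X Q Y t ω ∂μ :=
        mul_le_mul_of_nonneg_right hexp (integral_nonneg (bzRunOdds_nonneg hε t))
      _ ≤ Real.exp (-(1 / 2 - r)) * (((K : ℝ) - 1) * Real.exp (-∑ s ∈ Finset.range t,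
          (1 / 2 - √(ε (Fin.ofNat M s) * (1 - ε (Fin.ofNat M s)))))) :=
        mul_le_mul_of_nonneg_left ih (Real.exp_nonneg _)
      _ = _ := by
        rw [mul_left_comm, ← Real.exp_add, ← neg_add_rev, Finset.sum_range_succ]

theorem measureReal_lt_abs_sub_bzEstimate_le (hrun : IsBZRun μ ε K X Q Y)
    (hε : ∀ m, ε m ∈ Set.Ioo (0 : ℝ) 1) (n : ℕ) :
    μ.real {ω | 1 / (K : ℝ) < |X ω - bzEstimate ε K (fun t => Q t ω) (fun t => Y t ω) n|} ≤
      ((K : ℝ) - 1) * Real.exp (-(n * bzRate ε)) := by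
  have hsub : ∀ᵐ ω ∂μ, 1 / (K : ℝ) < |X ω - bzEstimate ε K (fun t => Q t ω) (fun t => Y t ω) n| →
      1 ≤ bzRunOdds ε K X Q Y (n * M) ω := by
    filter_upwards [hrun.target_mem] with ω hX hfar
    refine one_le_bzOdds (bzPosterior_pos hε _ _ _ _) (not_lt.1 fun hmass => hfar.not_ge ?_)
    exact abs_sub_bzMedian_le (bzPosterior_mem_stdSimplex hε _ _ _) hX hmass
  calc μ.real {ω | 1 / (K : ℝ) < |X ω - bzEstimate ε K (fun t => Q t ω) (fun t => Y t ω) n|}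
      ≤ μ.real {ω | 1 ≤ bzRunOdds ε K X Q Y (n * M) ω} :=
        ENNReal.toReal_mono (measure_ne_top _ _) (measure_mono_ae hsub)
    _ ≤ ∫ ω, bzRunOdds ε K X Q Y (n * M) ω ∂μ := by
        simpa only [one_mul] using mul_meas_ge_le_integral_of_nonneg
          (ae_of_all _ (bzRunOdds_nonneg hε _)) (hrun.integrable_bzRunOdds hε _) 1
    _ ≤ ((K : ℝ) - 1) * Real.exp (-(n * bzRate ε)) := by
        have hsum := sum_range_mul_comp_ofNat (fun m => 1 / 2 - √(ε m * (1 - ε m))) n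
        rw [nsmul_eq_mul] at hsum
        rw [bzRate, ← hsum]
        exact hrun.integral_bzRunOdds_le hε _

end IsBZRun

theorem sq_one_div_add_mul_exp_le_of_eq_ceil {K : ℕ} {x : ℝ}
    (hK : K = ⌈(2 : ℝ) ^ (1 / 3 : ℝ) * Real.exp (x / 3)⌉₊) :
    (1 / (K : ℝ)) ^ 2 + ((K : ℝ) - 1) * Real.exp (-x) ≤
      ((2 : ℝ) ^ (-(2 / 3) : ℝ) + (2 : ℝ) ^ (1 / 3 : ℝ)) * Real.exp (-(2 / 3 * x)) := by
  set A : ℝ := (2 : ℝ) ^ (1 / 3 : ℝ) * Real.exp (x / 3)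
  have hA : 0 < A := by positivity
  have hAK : A ≤ K := hK ▸ Nat.le_ceil A
  have hKA : (K : ℝ) - 1 ≤ A := by
    rw [hK]
    linarith [Nat.ceil_lt_add_one hA.le]
  have hdiscretization : (1 / A) ^ 2 = (2 : ℝ) ^ (-(2 / 3) : ℝ) * Real.exp (-(2 / 3 * x)) := by
    rw [one_div, inv_pow, mul_pow, mul_inv, Real.rpow_neg zero_le_two, Real.exp_neg,
      ← Real.rpow_natCast, ← Real.rpow_mul zero_le_two, ← Real.exp_nat_mul]
    congr 3
    · norm_num
    · push_cast
      ring
  have hfailure : A * Real.exp (-x) = (2 : ℝ) ^ (1 / 3 : ℝ) * Real.exp (-(2 / 3 * x)) := by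
    rw [mul_assoc, ← Real.exp_add]
    congr 2
    ring
  rw [add_mul, ← hdiscretization, ← hfailure]
  have hinv : 1 / (K : ℝ) ≤ 1 / A := one_div_le_one_div_of_le hA hAK
  gcongr

theorem theorem5_general {M : ℕ} [NeZero M] (ε : Fin M → ℝ) (hε : ∀ m, ε m ∈ Set.Ioo (0 : ℝ) 1)
    {Ω : Type*} [MeasurableSpace Ω] (μ : Measure Ω) [IsProbabilityMeasure μ]
    (K : ℕ) (hK : 0 < K) (Δ : ℝ) (hΔ : Δ = 1 / (K : ℝ))
    (X : Ω → ℝ) (Q : ℕ → Ω → ℕ) (Y : ℕ → Ω → Bool) (hrun : IsBZRun μ ε K X Q Y)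
    (Xhat : ℕ → Ω → ℝ)
    (hXhat : ∀ n ω, Xhat n ω = bzEstimate ε K (fun t => Q t ω) (fun t => Y t ω) n) :
    (∀ n : ℕ, μ.real {ω | Δ < |X ω - Xhat n ω|} ≤
      (1 / Δ - 1) * Real.exp (-(n * bzRate ε))) ∧
    (∀ n : ℕ, K = ⌈(2 : ℝ) ^ (1 / 3 : ℝ) * Real.exp (n * bzRate ε / 3)⌉₊ →
      Integrable (fun ω => (X ω - Xhat n ω) ^ 2) μ ∧
      ∫ ω, (X ω - Xhat n ω) ^ 2 ∂μ ≤
        ((2 : ℝ) ^ (-(2 / 3) : ℝ) + (2 : ℝ) ^ (1 / 3 : ℝ)) *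
          Real.exp (-(2 / 3 * (n * bzRate ε)))) := by
  have : NeZero K := ⟨hK.ne'⟩
  obtain rfl : Xhat = fun n ω => bzEstimate ε K (fun t => Q t ω) (fun t => Y t ω) n :=
    funext₂ hXhat
  subst hΔ
  have herror := hrun.measureReal_lt_abs_sub_bzEstimate_le hε
  have hmeas := fun n => hrun.measurable_target.sub (hrun.measurable_bzEstimate n)
  have hbound := fun n => hrun.ae_abs_sub_bzEstimate_le_one n
  refine ⟨fun n => by simpa only [one_div_one_div] using herror n, fun n hn => ⟨?_, ?_⟩⟩
  · exact integrable_sq_of_ae_abs_le_one (hmeas n) (hbound n)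
  · calc ∫ ω, (X ω - bzEstimate ε K (fun t => Q t ω) (fun t => Y t ω) n) ^ 2 ∂μ
        ≤ (1 / (K : ℝ)) ^ 2 + ((K : ℝ) - 1) * Real.exp (-(n * bzRate ε)) := by
          have hsq := integral_sq_le_sq_mul_add_measureReal (hmeas n) (hbound n) (1 / (K : ℝ))
          rw [probReal_univ, mul_one] at hsq
          exact hsq.trans (add_le_add_right (herror n) _)
      _ ≤ _ := sq_one_div_add_mul_exp_le_of_eq_ceil hn

theorem theorem5 {M : ℕ} [NeZero M] (ε : Fin M → ℝ) (hε : ∀ m, 0 < ε m ∧ ε m < 1 / 2)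
    {Ω : Type*} [MeasurableSpace Ω] (μ : Measure Ω) [IsProbabilityMeasure μ]
    (K : ℕ) (hK : 0 < K) (Δ : ℝ) (hΔ : Δ = 1 / (K : ℝ))
    (X : Ω → ℝ) (Q : ℕ → Ω → ℕ) (Y : ℕ → Ω → Bool) (hrun : IsBZRun μ ε K X Q Y)
    (Xhat : ℕ → Ω → ℝ)
    (hXhat : ∀ n ω, Xhat n ω = bzEstimate ε K (fun t => Q t ω) (fun t => Y t ω) n) :
    (∀ n : ℕ, μ.real {ω | Δ < |X ω - Xhat n ω|} ≤
      (1 / Δ - 1) * Real.exp (-(n * bzRate ε))) ∧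
    (∀ n : ℕ, K = ⌈(2 : ℝ) ^ (1 / 3 : ℝ) * Real.exp (n * bzRate ε / 3)⌉₊ →
      Integrable (fun ω => (X ω - Xhat n ω) ^ 2) μ ∧
      ∫ ω, (X ω - Xhat n ω) ^ 2 ∂μ ≤
        ((2 : ℝ) ^ (-(2 / 3) : ℝ) + (2 : ℝ) ^ (1 / 3 : ℝ)) *
          Real.exp (-(2 / 3 * (n * bzRate ε)))) :=
  theorem5_general ε (fun m => ⟨(hε m).1, (hε m).2.trans (by norm_num)⟩) μ K hK Δ hΔ X Q Y
    hrun Xhat hXhat
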